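/- Let $K_1$ and $K_2$ be finite abstract simplicial complexes on the vertex sets $[n]$ and $[m]$ (the empty simplex, of dimension $-1$, is a face of each). For such a complex $K$ let $S_i(K)$ be its set of $i$-dimensional faces, and let $C^i(K)$, $i\ge -1$, be the spaces of the augmented real simplicial cochain complex, with coboundary maps $\delta_i\colon C^i(K)\to C^{i+1}(K)$; put $C^i(K)=0$ for $i<-1$. A positive function $w$ on the faces of $K$ (a weight function) defines the scalar products $(f,g)_{C^i}=\sum_{F\in S_i(K)} w(F)f([F])g([F])$. With the adjoints $\delta_i^*$ for these scalar products put $$\mathcal L_i^{up}=\delta_i^*\delta_i,\qquad \mathcal L_i^{down}=\delta_{i-1}\delta_{i-1}^*,\qquad \mathcal L_i=\mathcal L_i^{up}+\mathcal L_i^{down}.$$ Write $\mathbf s(A)$ for the multiset of eigenvalues of $A$, and $S\stackrel{\circ}{=}T$ if the multisets $S$ and $T$ differ at most in the multiplicity of $0$. Recall that $\mathcal L_i^{up}\mathcal L_i^{down}=\mathcal L_i^{down}\mathcal L_i^{up}=0$, so the nonzero part of $\mathbf s(\mathcal L_i)$ is the union with multiplicities of the nonzero parts of $\mathbf s(\mathcal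 L_i^{up})$ and $\mathbf s(\mathcal L_i^{down})$; accordingly each nonzero member of the multiset $\mathbf s(\mathcal L_i)$ is labelled "up" or "down" (a number that occurs in both spectra occurs with both labels, with the respective multiplicities). The join $K_1*K_2$ is the simplicial complex on $[n+m]$ with the faces $F_1*F_2=F_1\cup\{n+u: u\in F_2\}$, $F_1\in K_1$, $F_2\in K_2$. Let $w_1,w_2$ be weight functions on $K_1,K_2$, let $p\colon\{-1,0,\dots,\dim K_1\}\to(0,\infty)$ and $q\colon\{-1,0,\dots,\dim K_2\}\to(0,\infty)$, and equip the cochain spaces of $K_1*K_2$ with the scalar products given by the weight function $$w(F_1*F_2)=p(\dim F_1)\,w_1(F_1)\,q(\dim F_2)\,w_2(F_2).$$ **Theorem.** For every $i$, with multiplicities, $$\mathbf s\big(\mathcal L_i(K_1*K_2)\big)\stackrel{\circ}{=}\bigcup_{\substack{i_1,i_2\ge -1\\ i_1+i_2+1=i}}\big\{P_\lambda\lambda+Q_\mu\mu \;:\; \lambda\in\mathbf s(\mathcal L_{i_1}(K_1)),\ \mu\in\mathbf s(\mathcal L_{i_2}(K_2))\big\},$$ where the union and the sets are to be read as multisets,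 $P_\lambda=p(i_1+1)/p(i_1)$ if $\lambda$ is labelled up and $P_\lambda=p(i_1)/p(i_1-1)$ if $\lambda$ is labelled down, and likewise $Q_\mu=q(i_2+1)/q(i_2)$ if $\mu$ is labelled up and $Q_\mu=q(i_2)/q(i_2-1)$ if $\mu$ is labelled down. (For $\lambda=0$ or $\mu=0$ the product $P_\lambda\lambda$ or $Q_\mu\mu$ is $0$.) -/

import Mathlib

noncomputable section

/-- An abstract simplicial complex on the finite vertex set `Fin n`: a collection of finite sets
closed under taking subsets.  The empty simplex is a face (of dimension `-1`), as is needed for the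
augmented cochain complex; it is not required that every element of `Fin n` spans a face. -/
structure FinComplex (n : ℕ) where
  faces : Finset (Finset (Fin n))
  empty_mem : ∅ ∈ faces
  down_closed : ∀ F ∈ faces, ∀ E, E ⊆ F → E ∈ faces

/-- The dimension of a simplex: its number of vertices minus one. -/
def faceDim {n : ℕ} (F : Finset (Fin n)) : ℤ := (F.card : ℤ) - 1

namespace FinComplex

variable {n m : ℕ}

/-- The dimension of a complex: the largest dimension of a face (`-1` for the complex `{∅}`). -/
def dim (K : FinComplex n) : ℤ := ((K.faces.sup Finset.card : ℕ) : ℤ) - 1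

/-- The set `S_i(K)` of `i`-dimensional faces. -/
abbrev Face (K : FinComplex n) (i : ℤ) : Type := {F : Finset (Fin n) // F ∈ K.faces ∧ faceDim F = i}

/-- The `i`-th cochain space, written in the basis of elementary cochains.  Every face is oriented
by the increasing order of its vertices, and `f F` is the value of the cochain on the face `F` with
this orientation. -/
abbrev Cochain (K : FinComplex n) (i : ℤ) : Type := K.Face i → ℝ

end FinComplex

/-- The sign of the face `E` in the boundary of the face `F`, both oriented increasingly: if
`E` arises from `F = {v₀ < v₁ < ⋯}` by omitting `v_k`, it is `(-1) ^ k` (here `k` is the number of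
vertices of `F` below the omitted vertex), and it is `0` if `E` is not of this form. -/
def incidence {n : ℕ} (E F : Finset (Fin n)) : ℝ :=
  ∑ v ∈ F, if F.erase v = E then (-1 : ℝ) ^ (F.filter (· < v)).card else 0

namespace FinComplex

variable {n m : ℕ}

/-- The simplicial coboundary map `C^i → C^j`, to be used with `j = i + 1`. -/
def coboundary (K : FinComplex n) (i j : ℤ) : K.Cochain i →ₗ[ℝ] K.Cochain j where
  toFun f := fun F => ∑ E : K.Face i, incidence E.1 F.1 * f E
  map_add' f g := by
    funext F
    simp [mul_add, Finset.sum_add_distrib]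
  map_smul' c f := by
    funext F
    simp [Finset.mul_sum, mul_left_comm]

/-- The scalar product on `C^i` given by a weight function `w` on the faces. -/
def cochainInner (K : FinComplex n) (w : Finset (Fin n) → ℝ) {i : ℤ} (f g : K.Cochain i) : ℝ :=
  ∑ F : K.Face i, w F.1 * f F * g F

/-- The adjoint `C^j → C^i` of the coboundary map `C^i → C^j` for the scalar products given by the
weight function `w`; see `cochainInner_coboundary` for the defining property. -/
def coboundaryAdjoint (K : FinComplex n) (w : Finset (Fin n) → ℝ) (i j : ℤ) :
    K.Cochain j →ₗ[ℝ] K.Cochain i where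
  toFun g := fun E => ∑ F : K.Face j, w F.1 / w E.1 * incidence E.1 F.1 * g F
  map_add' f g := by
    funext F
    simp [mul_add, Finset.sum_add_distrib]
  map_smul' c f := by
    funext F
    simp [Finset.mul_sum, mul_left_comm]

theorem cochainInner_coboundary (K : FinComplex n) (w : Finset (Fin n) → ℝ)
    (hw : ∀ F ∈ K.faces, 0 < w F) (i j : ℤ) (f : K.Cochain i) (g : K.Cochain j) :
    K.cochainInner w (K.coboundary i j f) g = K.cochainInner w f (K.coboundaryAdjoint w i j g) := by
  simp only [cochainInner, coboundary, coboundaryAdjoint, LinearMap.coe_mk, AddHom.coe_mk,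
    Finset.mul_sum, Finset.sum_mul]
  rw [Finset.sum_comm]
  refine Finset.sum_congr rfl fun E _ => Finset.sum_congr rfl fun F _ => ?_
  have := (hw E.1 E.2.1).ne'
  field_simp

/-- The `i`-up Laplace operator `δ_i^* δ_i`. -/
def lapUp (K : FinComplex n) (w : Finset (Fin n) → ℝ) (i : ℤ) : K.Cochain i →ₗ[ℝ] K.Cochain i :=
  K.coboundaryAdjoint w i (i + 1) ∘ₗ K.coboundary i (i + 1)

/-- The `i`-down Laplace operator `δ_{i-1} δ_{i-1}^*`. -/
def lapDown (K : FinComplex n) (w : Finset (Fin n) → ℝ) (i : ℤ) : K.Cochain i →ₗ[ℝ] K.Cochain i :=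
  K.coboundary (i - 1) i ∘ₗ K.coboundaryAdjoint w (i - 1) i

/-- The full `i`-Laplace operator `δ_i^* δ_i + δ_{i-1} δ_{i-1}^*`. -/
def lap (K : FinComplex n) (w : Finset (Fin n) → ℝ) (i : ℤ) : K.Cochain i →ₗ[ℝ] K.Cochain i :=
  K.lapUp w i + K.lapDown w i

/-- The coboundary in terms of omitted vertices:
`(δ f)(F) = ∑_k (-1)^k f({v₀, …, v_k omitted, …})`. -/
theorem coboundary_apply (K : FinComplex n) (i : ℤ) (f : K.Cochain i) (F : K.Face (i + 1)) :
    K.coboundary i (i + 1) f F = ∑ v : {v // v ∈ F.1},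
      (-1 : ℝ) ^ (F.1.filter (· < v.1)).card *
        f ⟨F.1.erase v.1, K.down_closed _ F.2.1 _ (Finset.erase_subset _ _), by
          have h := F.2.2
          have h2 := Finset.card_erase_add_one v.2
          simp only [faceDim] at h ⊢
          omega⟩ := by
  simp only [coboundary, LinearMap.coe_mk, AddHom.coe_mk, incidence, Finset.sum_mul]
  rw [Finset.sum_comm, ← Finset.sum_coe_sort]
  refine Finset.sum_congr rfl fun v _ => ?_
  rw [Finset.sum_eq_single ⟨F.1.erase v.1, K.down_closed _ F.2.1 _ (Finset.erase_subset _ _), by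
          have h := F.2.2
          have h2 := Finset.card_erase_add_one v.2
          simp only [faceDim] at h ⊢
          omega⟩]
  · simp
  · intro E _ hE
    rw [if_neg, zero_mul]
    rintro h
    exact hE (Subtype.ext h.symm)
  · simp

end FinComplex

/-- The multiset of (real) eigenvalues of an endomorphism, with algebraic multiplicities.  The
Laplace operators are self-adjoint, so for them this is the full spectrum with the usual
multiplicities. -/
def eigenvalues {V : Type} [AddCommGroup V] [Module ℝ V] [Module.Finite ℝ V] [Module.Free ℝ V]
    (T : V →ₗ[ℝ] V) : Multiset ℝ := T.charpoly.roots

/-- Two multisets of reals that differ at most in the multiplicity of zero. -/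
def EqUpToZeros (s t : Multiset ℝ) : Prop := s.filter (· ≠ 0) = t.filter (· ≠ 0)

/-- Whether an eigenvalue of the full Laplace operator comes from its up or its down part. -/
inductive LapPart
  | up
  | down

namespace FinComplex

variable {n m : ℕ}

/-- The spectrum of the full Laplace operator `lap w i`, with every eigenvalue labelled by the part
it comes from: the nonzero eigenvalues of the up operator, the nonzero eigenvalues of the down
operator, and the zero eigenvalues of the full operator with their multiplicity.
A nonzero real number occurring in both the up and the down spectrum occurs here with both labels,
with the respective multiplicities.  (The label of the eigenvalue zero does not matter,
because labels are only used to choose a factor by which the eigenvalue is multiplied.) -/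
def labelledSpectrum (K : FinComplex n) (w : Finset (Fin n) → ℝ) (i : ℤ) : Multiset (LapPart × ℝ) :=
  ((eigenvalues (K.lapUp w i)).filter (· ≠ 0)).map (fun x => (LapPart.up, x)) +
  ((eigenvalues (K.lapDown w i)).filter (· ≠ 0)).map (fun x => (LapPart.down, x)) +
  Multiset.replicate ((eigenvalues (K.lap w i)).count 0) (LapPart.up, 0)

end FinComplex

/-- The ratio by which an eigenvalue in degree `i` is multiplied. -/
def ratio (p : ℤ → ℝ) (i : ℤ) : LapPart → ℝ
  | LapPart.up => p (i + 1) / p i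
  | LapPart.down => p i / p (i - 1)

/-- The simplex `F * G = {v₀, …, v_k, n + u₀, …, n + u_l}` of a join. -/
def joinFace {n m : ℕ} (F : Finset (Fin n)) (G : Finset (Fin m)) : Finset (Fin (n + m)) :=
  F.map (Fin.castAddEmb m) ∪ G.map (Fin.natAddEmb n)

/-- The set of vertices of `A` that lie in the first vertex set. -/
def leftPart {n m : ℕ} (A : Finset (Fin (n + m))) : Finset (Fin n) :=
  Finset.univ.filter (fun v => Fin.castAdd m v ∈ A)

/-- The set of vertices of `A` that lie in the second vertex set. -/
def rightPart {n m : ℕ} (A : Finset (Fin (n + m))) : Finset (Fin m) :=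
  Finset.univ.filter (fun u => Fin.natAdd n u ∈ A)

theorem castAdd_ne_natAdd {n m : ℕ} (v : Fin n) (u : Fin m) : Fin.castAdd m v ≠ Fin.natAdd n u := by
  intro h
  have h2 := congrArg Fin.val h
  simp only [Fin.val_castAdd, Fin.val_natAdd] at h2
  omega

theorem leftPart_joinFace {n m : ℕ} (F : Finset (Fin n)) (G : Finset (Fin m)) :
    leftPart (joinFace F G) = F := by
  ext v
  simp [leftPart, joinFace, fun u => (castAdd_ne_natAdd v u).symm]

theorem rightPart_joinFace {n m : ℕ} (F : Finset (Fin n)) (G : Finset (Fin m)) :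
    rightPart (joinFace F G) = G := by
  ext v
  simp [rightPart, joinFace, fun u => (castAdd_ne_natAdd u v)]

theorem joinFace_leftPart_rightPart {n m : ℕ} (A : Finset (Fin (n + m))) :
    joinFace (leftPart A) (rightPart A) = A := by
  ext v
  induction v using Fin.addCases with
  | left v => simp [leftPart, joinFace, fun u => (castAdd_ne_natAdd v u).symm]
  | right u => simp [rightPart, joinFace, fun v => (castAdd_ne_natAdd v u)]

/-- The join of two complexes: its faces are the simplices `F * G` with `F` a face of the first
complex and `G` a face of the second one (either may be empty). -/
def FinComplex.join {n m : ℕ} (K : FinComplex n) (L : FinComplex m) : FinComplex (n + m) where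
  faces := (K.faces ×ˢ L.faces).image (fun x => joinFace x.1 x.2)
  empty_mem := Finset.mem_image.mpr
    ⟨(∅, ∅), Finset.mem_product.mpr ⟨K.empty_mem, L.empty_mem⟩, by simp [joinFace]⟩
  down_closed := by
    intro A hA B hB
    obtain ⟨⟨F, G⟩, hFG, rfl⟩ := Finset.mem_image.mp hA
    obtain ⟨hF, hG⟩ := Finset.mem_product.mp hFG
    refine Finset.mem_image.mpr ⟨(leftPart B, rightPart B), Finset.mem_product.mpr
      ⟨K.down_closed F hF _ ?_, L.down_closed G hG _ ?_⟩, joinFace_leftPart_rightPart B⟩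
    · rw [← leftPart_joinFace F G]
      exact fun v hv => by
        simp only [leftPart, Finset.mem_filter, Finset.mem_univ, true_and] at hv ⊢
        exact hB hv
    · rw [← rightPart_joinFace F G]
      exact fun v hv => by
        simp only [rightPart, Finset.mem_filter, Finset.mem_univ, true_and] at hv ⊢
        exact hB hv

/-- The weight function on the join that corresponds to the rescaled tensor product scalar product;
see `joinWeight_joinFace`. -/
def joinWeight {n m : ℕ} (p q : ℤ → ℝ) (w₁ : Finset (Fin n) → ℝ) (w₂ : Finset (Fin m) → ℝ)
    (A : Finset (Fin (n + m))) : ℝ :=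
  p (faceDim (leftPart A)) * w₁ (leftPart A) * (q (faceDim (rightPart A)) * w₂ (rightPart A))

theorem joinWeight_joinFace {n m : ℕ} (p q : ℤ → ℝ) (w₁ : Finset (Fin n) → ℝ)
    (w₂ : Finset (Fin m) → ℝ) (F : Finset (Fin n)) (G : Finset (Fin m)) :
    joinWeight p q w₁ w₂ (joinFace F G) = p (faceDim F) * w₁ F * (q (faceDim G) * w₂ G) := by
  simp only [joinWeight, leftPart_joinFace, rightPart_joinFace]


/-- The signs cancel in pairs, which gives `δ ∘ δ = 0` below. -/
theorem sum_incidence_mul_incidence {n : ℕ} (D F : Finset (Fin n)) :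
    ∑ v ∈ F, (-1 : ℝ) ^ (F.filter (· < v)).card * incidence D (F.erase v) = 0 := by
  have key : ∀ v ∈ F, ∀ u ∈ F, v < u →
      (-1 : ℝ) ^ (F.filter (· < v)).card * (-1 : ℝ) ^ ((F.erase v).filter (· < u)).card =
      -((-1 : ℝ) ^ (F.filter (· < u)).card * (-1 : ℝ) ^ ((F.erase u).filter (· < v)).card) := by
    intro v hv u hu h
    have h1 : ((F.erase v).filter (· < u)).card + 1 = (F.filter (· < u)).card := by
      rw [Finset.filter_erase]
      exact Finset.card_erase_add_one (by simp [hv, h])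
    have h2 : (F.erase u).filter (· < v) = F.filter (· < v) := by
      rw [Finset.filter_erase]
      exact Finset.erase_eq_of_notMem (by simp [h.le])
    rw [h2, ← h1]
    ring
  have e : ∑ v ∈ F, (-1 : ℝ) ^ (F.filter (· < v)).card * incidence D (F.erase v) =
      ∑ v ∈ F, ∑ u ∈ F, if v ≠ u ∧ (F.erase v).erase u = D then
        (-1 : ℝ) ^ (F.filter (· < v)).card * (-1 : ℝ) ^ ((F.erase v).filter (· < u)).card
        else 0 := by
    refine Finset.sum_congr rfl fun v hv => ?_
    rw [incidence, Finset.mul_sum, ← Finset.add_sum_erase F _ hv]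
    simp only [ne_eq, not_true_eq_false, false_and, if_false, zero_add]
    refine Finset.sum_congr rfl fun u hu => ?_
    have : v ≠ u := (Finset.ne_of_mem_erase hu).symm
    simp [this]
  have anti : ∑ v ∈ F, (-1 : ℝ) ^ (F.filter (· < v)).card * incidence D (F.erase v) =
      -∑ v ∈ F, (-1 : ℝ) ^ (F.filter (· < v)).card * incidence D (F.erase v) := by
    conv_rhs => rw [e, Finset.sum_comm]
    rw [e, ← Finset.sum_neg_distrib]
    refine Finset.sum_congr rfl fun v hv => ?_
    rw [← Finset.sum_neg_distrib]
    refine Finset.sum_congr rfl fun u hu => ?_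
    rw [Finset.erase_right_comm (a := u)]
    rcases lt_trichotomy v u with h | h | h
    · simp only [ne_eq, h.ne, h.ne', not_false_eq_true, true_and]
      rw [key v hv u hu h]
      split_ifs <;> simp
    · simp [h]
    · simp only [ne_eq, h.ne, h.ne', not_false_eq_true, true_and]
      rw [key u hu v hv h]
      split_ifs <;> simp
  linarith

theorem FinComplex.coboundary_comp_coboundary {n : ℕ} (K : FinComplex n) (i : ℤ) :
    K.coboundary i (i + 1) ∘ₗ K.coboundary (i - 1) i = 0 := by
  ext f F
  rw [LinearMap.comp_apply, LinearMap.comp_apply, coboundary_apply]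
  simp only [coboundary, LinearMap.coe_mk, AddHom.coe_mk, Finset.mul_sum]
  rw [Finset.sum_comm]
  simp only [← mul_assoc, ← Finset.sum_mul]
  refine Finset.sum_eq_zero fun D _ => ?_
  have := sum_incidence_mul_incidence D.1 F.1
  rw [← Finset.sum_coe_sort] at this
  rw [this, zero_mul]

/-- Forgetting the labels in the labelled spectrum gives the spectrum of the full Laplace operator,
with multiplicities. -/
theorem FinComplex.labelledSpectrum_map_snd {n : ℕ} (K : FinComplex n) (w : Finset (Fin n) → ℝ)
    (i : ℤ) : (K.labelledSpectrum w i).map Prod.snd = eigenvalues (K.lap w i) := by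
  have h0 : K.lapUp w i ∘ₗ K.lapDown w i = 0 := by
    rw [lapUp, lapDown, LinearMap.comp_assoc, ← LinearMap.comp_assoc (K.coboundaryAdjoint _ _ _),
      coboundary_comp_coboundary]
    simp
  have hroots : eigenvalues (K.lapUp w i) + eigenvalues (K.lapDown w i) =
      Multiset.replicate (Fintype.card (K.Face i)) 0 + eigenvalues (K.lap w i) := by
    have h1 : (K.lapUp w i).charpoly * (K.lapDown w i).charpoly =
        Polynomial.X ^ Fintype.card (K.Face i) * (K.lap w i).charpoly := by
      set b := Pi.basisFun ℝ (K.Face i)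
      rw [← LinearMap.charpoly_toMatrix (K.lapUp w i) b, ← LinearMap.charpoly_toMatrix (K.lapDown w i) b,
        ← LinearMap.charpoly_toMatrix (K.lap w i) b, lap, map_add]
      have hAB : LinearMap.toMatrix b b (K.lapUp w i) * LinearMap.toMatrix b b (K.lapDown w i) = 0 := by
        rw [← LinearMap.toMatrix_comp, h0, map_zero]
      generalize LinearMap.toMatrix b b (K.lapUp w i) = A at hAB ⊢
      generalize LinearMap.toMatrix b b (K.lapDown w i) = B at hAB ⊢
      have hs : (Polynomial.X : Polynomial ℝ) ^ Fintype.card (K.Face i) =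
          (Matrix.scalar (K.Face i) (Polynomial.X : Polynomial ℝ)).det := by
        simp
      rw [Matrix.charpoly, Matrix.charpoly, Matrix.charpoly, hs, ← Matrix.det_mul, ← Matrix.det_mul]
      congr 1
      have hAB' : Polynomial.C.mapMatrix A * Polynomial.C.mapMatrix B = 0 := by
        rw [← map_mul, hAB, map_zero]
      have hc := (Matrix.scalar_commute (Polynomial.X : Polynomial ℝ) (fun r => mul_comm _ _)
        (Polynomial.C.mapMatrix A)).eq
      simp only [Matrix.charmatrix, map_add]
      rw [sub_mul, mul_sub, mul_sub, hAB', mul_sub, mul_add, ← hc]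
      abel
    have h2 := congrArg Polynomial.roots h1
    rw [Polynomial.roots_mul (mul_ne_zero (LinearMap.charpoly_monic _).ne_zero
      (LinearMap.charpoly_monic _).ne_zero), Polynomial.roots_mul (mul_ne_zero
      (pow_ne_zero _ Polynomial.X_ne_zero) (LinearMap.charpoly_monic _).ne_zero),
      Polynomial.roots_X_pow, Multiset.nsmul_singleton] at h2
    exact h2
  have hf := congrArg (Multiset.filter (· ≠ 0)) hroots
  rw [Multiset.filter_add, Multiset.filter_add,
    (Multiset.filter_eq_nil (s := Multiset.replicate _ (0 : ℝ))).mpr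
      (fun a ha => by simp [Multiset.eq_of_mem_replicate ha]), zero_add] at hf
  rw [labelledSpectrum, Multiset.map_add, Multiset.map_add, Multiset.map_map, Multiset.map_map,
    Multiset.map_replicate]
  simp only [Function.comp_def, Multiset.map_id']
  rw [hf, ← Multiset.filter_eq', add_comm]
  conv_rhs => rw [← Multiset.filter_add_not (· = (0 : ℝ)) (eigenvalues (K.lap w i))]

end

noncomputable section

/-! The cochains of the join in degree `i` are the direct sum of the tensor products of cochain
spaces of the factors in degrees `i₁` and `i₂` with `i₁ + i₂ + 1 = i`. Exterior products (`cross`)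
realise this. Since the vertices of the second factor come last, the coboundary obeys a Leibniz rule
with sign `(-1) ^ (i₁ + 1)` (`coboundary_cross`). The join weight is a product, so the adjoint obeys
one too, each term carrying a ratio of consecutive values of `p` or `q` (`coboundaryAdjoint_cross`).
When both rules are combined, the mixed terms `δf × δ*g` and `δ*f × δg` from the up and down parts
have equal ratios and opposite signs and cancel. So the Laplacian acts on `f × g` through each
factor separately, with up and down parts rescaled by their own ratios (`lap_cross`).

It remains to diagonalise up and down parts simultaneously. They are nonnegative and annihilate each
other, so one self-adjoint operator suffices: the difference `lapUp - lapDown`. Its eigenvectors are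
eigenvectors of both parts, and the sign of the eigenvalue is the label
(`lapUp_and_lapDown_of_sub`). Exterior products of such eigenvectors form an eigenbasis for the
join, so equality of spectra holds with the multiplicity of zero included. -/

/-! ### Eigenbases and the spectral theorem for a given scalar product -/

theorem eigenvalues_eq_of_basis {V ι : Type} [AddCommGroup V] [Module ℝ V] [Module.Finite ℝ V]
    [Module.Free ℝ V] [Fintype ι] {T : V →ₗ[ℝ] V} (b : Module.Basis ι ℝ V) {μ : ι → ℝ}
    (h : ∀ j, T (b j) = μ j • b j) : eigenvalues T = Finset.univ.val.map μ := by
  classical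
  have hM : LinearMap.toMatrix b b T = Matrix.diagonal μ := by
    ext i j
    rw [LinearMap.toMatrix_apply, h, map_smul, Finsupp.smul_apply, b.repr_self,
      Matrix.diagonal_apply, Finsupp.single_apply]
    by_cases hij : i = j
    · simp [hij]
    · simp [hij, Ne.symm hij]
  rw [eigenvalues, ← LinearMap.charpoly_toMatrix T b, hM, Matrix.charpoly_diagonal]
  exact Polynomial.roots_multiset_prod_X_sub_C (Finset.univ.val.map μ) ▸ by
    rw [Multiset.map_map]; rfl

/-- The spectral theorem for the inner product `B`. Working on an abstract `V` lets the norm of `B`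
be installed without competing with the sup norm that a space of functions already carries. -/
theorem exists_eigenbasis_of_symmetric {V ι : Type} [AddCommGroup V] [Module ℝ V]
    [Module.Finite ℝ V] [Fintype ι] (b₀ : Module.Basis ι ℝ V) (B : V →ₗ[ℝ] V →ₗ[ℝ] ℝ)
    (symm : ∀ x y, B x y = B y x) (nonneg : ∀ x, 0 ≤ B x x) (definite : ∀ x, B x x = 0 → x = 0)
    (T : V →ₗ[ℝ] V) (hT : ∀ x y, B (T x) y = B x (T y)) :
    ∃ (b : Module.Basis ι ℝ V) (μ : ι → ℝ), ∀ j, T (b j) = μ j • b j := by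
  let c : InnerProductSpace.Core ℝ V :=
    { inner := fun x y => B x y
      conj_inner_symm := fun x y => symm y x
      re_inner_nonneg := fun x => nonneg x
      add_left := fun x y z => by simp
      smul_left := fun x y r => by simp
      definite := definite }
  let _ : NormedAddCommGroup V := c.toNormedAddCommGroup
  let _ : InnerProductSpace ℝ V := InnerProductSpace.ofCore c.toCore
  have hs : T.IsSymmetric := fun x y => hT x y
  have hn : Module.finrank ℝ V = Fintype.card ι := Module.finrank_eq_card_basis b₀
  let e := (Fintype.equivFin ι).symm
  refine ⟨(hs.eigenvectorBasis hn).toBasis.reindex e, fun j => hs.eigenvalues hn (e.symm j),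
    fun j => ?_⟩
  rw [Module.Basis.reindex_apply, OrthonormalBasis.coe_toBasis]
  exact hs.apply_eigenvectorBasis hn _

/-! ### Simultaneous diagonalisation of the up and down operators -/

namespace FinComplex

variable {n m : ℕ}

/-- The label and the absolute value of an eigenvalue of `lapUp - lapDown`. -/
def lapLabel (x : ℝ) : LapPart × ℝ := if x < 0 then (LapPart.down, -x) else (LapPart.up, x)

/-- The weighted scalar product as a bilinear map. -/
def cochainForm (K : FinComplex n) (w : Finset (Fin n) → ℝ) (i : ℤ) :
    K.Cochain i →ₗ[ℝ] K.Cochain i →ₗ[ℝ] ℝ :=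
  LinearMap.mk₂ ℝ (fun f g => K.cochainInner w f g)
    (fun f f' g => by simp [cochainInner, mul_add, add_mul, Finset.sum_add_distrib])
    (fun c f g => by
      simp only [cochainInner, Pi.smul_apply, smul_eq_mul, Finset.mul_sum]
      exact Finset.sum_congr rfl fun _ _ => by ring)
    (fun f g g' => by simp [cochainInner, mul_add, Finset.sum_add_distrib])
    (fun c f g => by
      simp only [cochainInner, Pi.smul_apply, smul_eq_mul, Finset.mul_sum]
      exact Finset.sum_congr rfl fun _ _ => by ring)

theorem cochainForm_apply (K : FinComplex n) (w : Finset (Fin n) → ℝ) (i : ℤ)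
    (f g : K.Cochain i) : K.cochainForm w i f g = ∑ F : K.Face i, w F.1 * f F * g F := rfl

theorem cochainForm_comm (K : FinComplex n) (w : Finset (Fin n) → ℝ) (i : ℤ)
    (f g : K.Cochain i) : K.cochainForm w i f g = K.cochainForm w i g f := by
  simp only [cochainForm_apply]
  exact Finset.sum_congr rfl fun _ _ => by ring

theorem cochainForm_self_nonneg (K : FinComplex n) {w : Finset (Fin n) → ℝ}
    (hw : ∀ F ∈ K.faces, 0 < w F) (i : ℤ) (f : K.Cochain i) : 0 ≤ K.cochainForm w i f f := by
  rw [cochainForm_apply]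
  refine Finset.sum_nonneg fun F _ => ?_
  rw [mul_assoc]
  exact mul_nonneg (hw F.1 F.2.1).le (mul_self_nonneg _)

theorem eq_zero_of_cochainForm_self (K : FinComplex n) {w : Finset (Fin n) → ℝ}
    (hw : ∀ F ∈ K.faces, 0 < w F) (i : ℤ) (f : K.Cochain i) (h : K.cochainForm w i f f = 0) :
    f = 0 := by
  rw [cochainForm_apply, Finset.sum_eq_zero_iff_of_nonneg (fun F _ => by
    rw [mul_assoc]
    exact mul_nonneg (hw F.1 F.2.1).le (mul_self_nonneg _))] at h
  funext F
  have := h F (Finset.mem_univ _)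
  rw [mul_assoc, mul_eq_zero, mul_self_eq_zero] at this
  exact this.resolve_left (hw F.1 F.2.1).ne'

theorem cochainForm_coboundary (K : FinComplex n) {w : Finset (Fin n) → ℝ}
    (hw : ∀ F ∈ K.faces, 0 < w F) (i j : ℤ) (f : K.Cochain i) (g : K.Cochain j) :
    K.cochainForm w j (K.coboundary i j f) g =
      K.cochainForm w i f (K.coboundaryAdjoint w i j g) :=
  K.cochainInner_coboundary w hw i j f g

theorem cochainForm_lapUp (K : FinComplex n) {w : Finset (Fin n) → ℝ}
    (hw : ∀ F ∈ K.faces, 0 < w F) (i : ℤ) (f g : K.Cochain i) :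
    K.cochainForm w i (K.lapUp w i f) g = K.cochainForm w i f (K.lapUp w i g) := by
  rw [cochainForm_comm, lapUp, LinearMap.comp_apply, ← cochainForm_coboundary K hw,
    cochainForm_comm, cochainForm_coboundary K hw, LinearMap.comp_apply]

theorem cochainForm_lapDown (K : FinComplex n) {w : Finset (Fin n) → ℝ}
    (hw : ∀ F ∈ K.faces, 0 < w F) (i : ℤ) (f g : K.Cochain i) :
    K.cochainForm w i (K.lapDown w i f) g = K.cochainForm w i f (K.lapDown w i g) := by
  rw [lapDown, LinearMap.comp_apply, cochainForm_coboundary K hw, cochainForm_comm,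
    ← cochainForm_coboundary K hw, cochainForm_comm, LinearMap.comp_apply]

theorem lapUp_lapDown (K : FinComplex n) (w : Finset (Fin n) → ℝ) (i : ℤ) (f : K.Cochain i) :
    K.lapUp w i (K.lapDown w i f) = 0 := by
  have h := LinearMap.congr_fun (K.coboundary_comp_coboundary i) (K.coboundaryAdjoint w (i - 1) i f)
  simp only [LinearMap.comp_apply, LinearMap.zero_apply] at h
  simp only [lapUp, lapDown, LinearMap.comp_apply, h, map_zero]

/-- The adjoint of `lapUp_lapDown`, as both operators are self-adjoint. -/
theorem lapDown_lapUp (K : FinComplex n) {w : Finset (Fin n) → ℝ}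
    (hw : ∀ F ∈ K.faces, 0 < w F) (i : ℤ) (f : K.Cochain i) :
    K.lapDown w i (K.lapUp w i f) = 0 := by
  refine K.eq_zero_of_cochainForm_self hw i _ ?_
  rw [cochainForm_lapDown K hw, cochainForm_lapUp K hw, lapUp_lapDown, map_zero]

theorem cochainForm_lapUp_self_nonneg (K : FinComplex n) {w : Finset (Fin n) → ℝ}
    (hw : ∀ F ∈ K.faces, 0 < w F) (i : ℤ) (f : K.Cochain i) :
    0 ≤ K.cochainForm w i (K.lapUp w i f) f := by
  rw [cochainForm_comm, lapUp, LinearMap.comp_apply, ← cochainForm_coboundary K hw]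
  exact K.cochainForm_self_nonneg hw _ _

theorem cochainForm_lapDown_self_nonneg (K : FinComplex n) {w : Finset (Fin n) → ℝ}
    (hw : ∀ F ∈ K.faces, 0 < w F) (i : ℤ) (f : K.Cochain i) :
    0 ≤ K.cochainForm w i (K.lapDown w i f) f := by
  rw [lapDown, LinearMap.comp_apply, cochainForm_coboundary K hw]
  exact K.cochainForm_self_nonneg hw _ _

/-- An eigenvector of the difference of the up and down Laplace operators is an eigenvector of both,
and the sign of the eigenvalue tells which one of them acts as zero. -/
theorem lapUp_and_lapDown_of_sub (K : FinComplex n) {w : Finset (Fin n) → ℝ}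
    (hw : ∀ F ∈ K.faces, 0 < w F) (i : ℤ) (f : K.Cochain i) (x : ℝ)
    (h : (K.lapUp w i - K.lapDown w i) f = x • f) :
    K.lapUp w i f = max x 0 • f ∧ K.lapDown w i f = max (-x) 0 • f := by
  rw [LinearMap.sub_apply] at h
  -- Applying either operator to the eigenvalue equation kills the other one. Hence the up part of
  -- `f` is an eigenvector for `x` and the down part for `-x`, unless zero; nonnegativity then
  -- excludes the wrong sign of `x`.
  have hu : K.lapUp w i (K.lapUp w i f) = x • K.lapUp w i f := by
    rw [← map_smul, ← h, map_sub, lapUp_lapDown, sub_zero]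
  have hd : K.lapDown w i (K.lapDown w i f) = -x • K.lapDown w i f := by
    rw [neg_smul, ← map_smul, ← h, map_sub, lapDown_lapUp K hw, zero_sub, neg_neg]
  have up_zero : x ≤ 0 → K.lapUp w i f = 0 := fun hx => by
    refine K.eq_zero_of_cochainForm_self hw i _ (le_antisymm ?_ (K.cochainForm_self_nonneg hw i _))
    rw [← cochainForm_lapUp K hw, hu, map_smul, LinearMap.smul_apply, smul_eq_mul]
    exact mul_nonpos_of_nonpos_of_nonneg hx (K.cochainForm_lapUp_self_nonneg hw i f)
  have down_zero : 0 ≤ x → K.lapDown w i f = 0 := fun hx => by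
    refine K.eq_zero_of_cochainForm_self hw i _ (le_antisymm ?_ (K.cochainForm_self_nonneg hw i _))
    rw [← cochainForm_lapDown K hw, hd, map_smul, LinearMap.smul_apply, smul_eq_mul, neg_mul]
    exact neg_nonpos.mpr (mul_nonneg hx (K.cochainForm_lapDown_self_nonneg hw i f))
  rcases le_total x 0 with hx | hx
  · have hu0 := up_zero hx
    rw [hu0, zero_sub] at h
    refine ⟨by rw [hu0, max_eq_right hx, zero_smul], ?_⟩
    rw [max_eq_left (neg_nonneg.mpr hx), neg_smul, ← h, neg_neg]
  · have hd0 := down_zero hx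
    rw [hd0, sub_zero] at h
    refine ⟨by rw [h, max_eq_left hx], ?_⟩
    rw [hd0, max_eq_right (neg_nonpos.mpr hx), zero_smul]

theorem exists_lap_eigenbasis (K : FinComplex n) {w : Finset (Fin n) → ℝ}
    (hw : ∀ F ∈ K.faces, 0 < w F) (i : ℤ) :
    ∃ (b : Module.Basis (K.Face i) ℝ (K.Cochain i)) (μ : K.Face i → ℝ), ∀ j,
      K.lapUp w i (b j) = max (μ j) 0 • b j ∧ K.lapDown w i (b j) = max (-μ j) 0 • b j := by
  obtain ⟨b, μ, h⟩ := exists_eigenbasis_of_symmetric (Pi.basisFun ℝ (K.Face i))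
    (K.cochainForm w i) (K.cochainForm_comm w i) (K.cochainForm_self_nonneg hw i)
    (K.eq_zero_of_cochainForm_self hw i) (K.lapUp w i - K.lapDown w i) (fun f g => by
      simp only [LinearMap.sub_apply, map_sub, cochainForm_lapUp K hw, cochainForm_lapDown K hw])
  exact ⟨b, μ, fun j => K.lapUp_and_lapDown_of_sub hw i _ _ (h j)⟩

theorem labelledSpectrum_eq_of_basis (K : FinComplex n) (w : Finset (Fin n) → ℝ) (i : ℤ)
    {ι : Type} [Fintype ι] (b : Module.Basis ι ℝ (K.Cochain i)) (μ : ι → ℝ)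
    (h : ∀ j, K.lapUp w i (b j) = max (μ j) 0 • b j ∧ K.lapDown w i (b j) = max (-μ j) 0 • b j) :
    K.labelledSpectrum w i = Finset.univ.val.map (fun j => lapLabel (μ j)) := by
  have hlap : ∀ j, K.lap w i (b j) = (max (μ j) 0 + max (-μ j) 0) • b j := fun j => by
    rw [lap, LinearMap.add_apply, (h j).1, (h j).2, add_smul]
  rw [labelledSpectrum, eigenvalues_eq_of_basis b fun j => (h j).1,
    eigenvalues_eq_of_basis b fun j => (h j).2, eigenvalues_eq_of_basis b hlap]
  -- All multisets are now images of one index multiset, so induction on it applies. According to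
  -- the sign of `μ a`, the index `a` contributes to exactly one of the up, down and zero summands.
  generalize (Finset.univ : Finset ι).val = s
  induction s using Multiset.induction with
  | empty => simp
  | cons a s ih =>
    rw [Multiset.map_cons, Multiset.map_cons, Multiset.map_cons, Multiset.map_cons, ← ih]
    rcases lt_trichotomy (μ a) 0 with ha | ha | ha
    · have h1 : max (μ a) 0 = 0 := max_eq_right ha.le
      have h2 : max (-μ a) 0 = -μ a := max_eq_left (by linarith)
      simp [h1, h2, lapLabel, ha, ha.ne]
    · simp [lapLabel, ha, Multiset.replicate_succ]
    · have h1 : max (μ a) 0 = μ a := max_eq_left ha.le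
      have h2 : max (-μ a) 0 = 0 := max_eq_right (by linarith)
      simp [h1, h2, lapLabel, ha.ne, ha.ne', not_lt.mpr ha.le]

end FinComplex

/-! ### Combinatorics and signs of joins of simplices -/

theorem joinFace_inj {n m : ℕ} {F F' : Finset (Fin n)} {G G' : Finset (Fin m)} :
    joinFace F G = joinFace F' G' ↔ F = F' ∧ G = G' := by
  refine ⟨fun h => ⟨?_, ?_⟩, fun h => by rw [h.1, h.2]⟩
  · rw [← leftPart_joinFace F G, h, leftPart_joinFace]
  · rw [← rightPart_joinFace F G, h, rightPart_joinFace]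

theorem disjoint_map_castAdd_map_natAdd {n m : ℕ} (F : Finset (Fin n)) (G : Finset (Fin m)) :
    Disjoint (F.map (Fin.castAddEmb m)) (G.map (Fin.natAddEmb n)) := by
  rw [Finset.disjoint_left]
  intro x hx hy
  obtain ⟨v, _, rfl⟩ := Finset.mem_map.mp hx
  obtain ⟨u, _, hu⟩ := Finset.mem_map.mp hy
  exact castAdd_ne_natAdd v u hu.symm

theorem card_joinFace {n m : ℕ} (F : Finset (Fin n)) (G : Finset (Fin m)) :
    (joinFace F G).card = F.card + G.card := by
  rw [joinFace, Finset.card_union_of_disjoint (disjoint_map_castAdd_map_natAdd F G),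
    Finset.card_map, Finset.card_map]

theorem sum_joinFace {n m : ℕ} (F : Finset (Fin n)) (G : Finset (Fin m)) (a : Fin (n + m) → ℝ) :
    ∑ x ∈ joinFace F G, a x = ∑ v ∈ F, a (Fin.castAdd m v) + ∑ u ∈ G, a (Fin.natAdd n u) := by
  rw [joinFace, Finset.sum_union (disjoint_map_castAdd_map_natAdd F G), Finset.sum_map,
    Finset.sum_map]
  rfl

theorem erase_castAdd_joinFace {n m : ℕ} (F : Finset (Fin n)) (G : Finset (Fin m)) (v : Fin n) :
    (joinFace F G).erase (Fin.castAdd m v) = joinFace (F.erase v) G := by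
  ext x
  induction x using Fin.addCases with
  | left x => simp [joinFace, fun u => (castAdd_ne_natAdd x u).symm]
  | right x => simp [joinFace, fun u => (castAdd_ne_natAdd u x), (castAdd_ne_natAdd v x).symm]

theorem erase_natAdd_joinFace {n m : ℕ} (F : Finset (Fin n)) (G : Finset (Fin m)) (u : Fin m) :
    (joinFace F G).erase (Fin.natAdd n u) = joinFace F (G.erase u) := by
  ext x
  induction x using Fin.addCases with
  | left x => simp [joinFace, fun u => (castAdd_ne_natAdd x u).symm, castAdd_ne_natAdd]
  | right x => simp [joinFace, fun u => (castAdd_ne_natAdd u x)]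

theorem castAdd_lt_castAdd {n : ℕ} (m : ℕ) (v v' : Fin n) :
    Fin.castAdd m v < Fin.castAdd m v' ↔ v < v' := Iff.rfl

theorem castAdd_lt_natAdd {n m : ℕ} (v : Fin n) (u : Fin m) :
    Fin.castAdd m v < Fin.natAdd n u := v.2.trans_le (Nat.le_add_right n u)

theorem card_filter_lt_castAdd_joinFace {n m : ℕ} (F : Finset (Fin n)) (G : Finset (Fin m))
    (v : Fin n) : ((joinFace F G).filter (· < Fin.castAdd m v)).card = (F.filter (· < v)).card := by
  have : (joinFace F G).filter (· < Fin.castAdd m v) = joinFace (F.filter (· < v)) ∅ := by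
    ext x
    induction x using Fin.addCases with
    | left x =>
      simp [joinFace, castAdd_lt_castAdd, fun u => (castAdd_ne_natAdd x u).symm, and_comm]
    | right x =>
      simp [joinFace, fun u => (castAdd_ne_natAdd u x), (castAdd_lt_natAdd v x).not_gt]
  rw [this, card_joinFace, Finset.card_empty, add_zero]

theorem card_filter_lt_natAdd_joinFace {n m : ℕ} (F : Finset (Fin n)) (G : Finset (Fin m))
    (u : Fin m) :
    ((joinFace F G).filter (· < Fin.natAdd n u)).card = F.card + (G.filter (· < u)).card := by
  have : (joinFace F G).filter (· < Fin.natAdd n u) = joinFace F (G.filter (· < u)) := by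
    ext x
    induction x using Fin.addCases with
    | left x => simp [joinFace, fun u => (castAdd_ne_natAdd x u).symm, castAdd_lt_natAdd]
    | right x => simp [joinFace, fun u => (castAdd_ne_natAdd u x)]
  rw [this, card_joinFace]

/-- The sign rule for the boundary of a join. -/
theorem incidence_joinFace {n m : ℕ} (E F : Finset (Fin n)) (D G : Finset (Fin m)) :
    incidence (joinFace E D) (joinFace F G) =
      (if D = G then incidence E F else 0) +
        (if E = F then (-1 : ℝ) ^ F.card * incidence D G else 0) := by
  rw [incidence, sum_joinFace]
  simp only [erase_castAdd_joinFace, erase_natAdd_joinFace, card_filter_lt_castAdd_joinFace,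
    card_filter_lt_natAdd_joinFace, joinFace_inj]
  congr 1
  · split_ifs with h
    · simp [h, incidence]
    · simp [Ne.symm h]
  · split_ifs with h
    · simp [h, incidence, Finset.mul_sum, pow_add]
    · simp [Ne.symm h]

theorem card_of_incidence_ne_zero {n : ℕ} {E F : Finset (Fin n)} (h : incidence E F ≠ 0) :
    E.card + 1 = F.card := by
  obtain ⟨v, hv, hne⟩ := Finset.exists_ne_zero_of_sum_ne_zero h
  have hE : F.erase v = E := by
    by_contra hE
    simp [hE] at hne
  rw [← hE, Finset.card_erase_add_one hv]

theorem faceDim_of_incidence_ne_zero {n : ℕ} {E F : Finset (Fin n)} (h : incidence E F ≠ 0) :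
    faceDim F = faceDim E + 1 := by
  have := card_of_incidence_ne_zero h
  simp only [faceDim]
  omega

theorem faceDim_joinFace {n m : ℕ} (F : Finset (Fin n)) (G : Finset (Fin m)) :
    faceDim (joinFace F G) = faceDim F + faceDim G + 1 := by
  simp only [faceDim, card_joinFace]
  push_cast
  ring

/-- A sum over all simplices of a join, as a double sum. -/
theorem sum_finset_join {n m : ℕ} (a : Finset (Fin (n + m)) → ℝ) :
    ∑ A, a A = ∑ F : Finset (Fin n), ∑ G : Finset (Fin m), a (joinFace F G) := by
  rw [← Fintype.sum_prod_type' (fun F G => a (joinFace F G))]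
  refine (Fintype.sum_bijective (fun x : Finset (Fin n) × Finset (Fin m) => joinFace x.1 x.2)
    ⟨fun x y h => Prod.ext (joinFace_inj.mp h).1 (joinFace_inj.mp h).2,
      fun A => ⟨(leftPart A, rightPart A), joinFace_leftPart_rightPart A⟩⟩ _ _ fun x => rfl).symm

/-! ### Cochains extended by zero to all simplices -/

namespace FinComplex

variable {n m : ℕ}

theorem joinFace_mem_join {K : FinComplex n} {L : FinComplex m} {F : Finset (Fin n)}
    {G : Finset (Fin m)} : joinFace F G ∈ (K.join L).faces ↔ F ∈ K.faces ∧ G ∈ L.faces := by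
  simp only [join, Finset.mem_image, Finset.mem_product, Prod.exists]
  constructor
  · rintro ⟨F', G', ⟨hF, hG⟩, h⟩
    rw [joinFace_inj] at h
    exact ⟨h.1 ▸ hF, h.2 ▸ hG⟩
  · rintro ⟨hF, hG⟩
    exact ⟨F, G, ⟨hF, hG⟩, rfl⟩

theorem faceDim_le_dim (K : FinComplex n) {F : Finset (Fin n)} (hF : F ∈ K.faces) :
    faceDim F ≤ K.dim := by
  have : F.card ≤ K.faces.sup Finset.card := Finset.le_sup hF
  simp only [faceDim, dim]
  omega

/-- The extension of a cochain by zero to all simplices. -/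
def extend (K : FinComplex n) {i : ℤ} (f : K.Cochain i) (F : Finset (Fin n)) : ℝ :=
  if h : F ∈ K.faces ∧ faceDim F = i then f ⟨F, h⟩ else 0

theorem extend_coe (K : FinComplex n) {i : ℤ} (f : K.Cochain i) (F : K.Face i) :
    K.extend f F.1 = f F := dif_pos F.2

theorem mem_of_extend_ne_zero {K : FinComplex n} {i : ℤ} {f : K.Cochain i} {F : Finset (Fin n)}
    (h : K.extend f F ≠ 0) : F ∈ K.faces ∧ faceDim F = i := by
  by_contra hF
  exact h (dif_neg hF)

theorem extend_add (K : FinComplex n) {i : ℤ} (f g : K.Cochain i) (F : Finset (Fin n)) :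
    K.extend (f + g) F = K.extend f F + K.extend g F := by
  simp only [extend]
  split_ifs <;> simp

theorem extend_smul (K : FinComplex n) {i : ℤ} (c : ℝ) (f : K.Cochain i) (F : Finset (Fin n)) :
    K.extend (c • f) F = c * K.extend f F := by
  simp only [extend]
  split_ifs <;> simp

theorem sum_face (K : FinComplex n) {i : ℤ} (a : Finset (Fin n) → ℝ)
    (ha : ∀ F, ¬(F ∈ K.faces ∧ faceDim F = i) → a F = 0) :
    ∑ F : K.Face i, a F.1 = ∑ F, a F := by
  rw [← Finset.sum_filter_of_ne (p := fun F => F ∈ K.faces ∧ faceDim F = i)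
    (fun F _ h => not_not.mp fun h' => h (ha F h'))]
  exact (Finset.sum_subtype _ (by simp) a).symm

/-- The sum may run over all simplices, since incidence and support together force the degree. The
condition that `F` is a face is essential: on a non-face the left side is zero, while its boundary
may lie in `K` and make the right side nonzero. -/
theorem extend_coboundary (K : FinComplex n) {i j : ℤ} (hj : j = i + 1) (f : K.Cochain i)
    {F : Finset (Fin n)} (hF : F ∈ K.faces) :
    K.extend (K.coboundary i j f) F = ∑ E, incidence E F * K.extend f E := by
  by_cases h : faceDim F = j
  · rw [extend, dif_pos ⟨hF, h⟩, ← sum_face K (i := i) _ fun E hE => by rw [extend, dif_neg hE,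
      mul_zero]]
    simp only [extend_coe]
    rfl
  · rw [extend, dif_neg fun h' => h h'.2, eq_comm]
    refine Finset.sum_eq_zero fun E _ => ?_
    by_contra hne
    have h1 := faceDim_of_incidence_ne_zero (left_ne_zero_of_mul hne)
    have h2 := (mem_of_extend_ne_zero (right_ne_zero_of_mul hne)).2
    omega

theorem extend_coboundaryAdjoint (K : FinComplex n) (w : Finset (Fin n) → ℝ) {i j : ℤ}
    (hj : j = i + 1) (g : K.Cochain j) {E : Finset (Fin n)} (hE : E ∈ K.faces) :
    K.extend (K.coboundaryAdjoint w i j g) E =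
      ∑ F, w F / w E * incidence E F * K.extend g F := by
  by_cases h : faceDim E = i
  · rw [extend, dif_pos ⟨hE, h⟩, ← sum_face K (i := j) _ fun F hF => by
      rw [extend, dif_neg hF, mul_zero]]
    simp only [extend_coe]
    rfl
  · rw [extend, dif_neg fun h' => h h'.2, eq_comm]
    refine Finset.sum_eq_zero fun F _ => ?_
    by_contra hne
    have h1 := faceDim_of_incidence_ne_zero (right_ne_zero_of_mul (left_ne_zero_of_mul hne))
    have h2 := (mem_of_extend_ne_zero (right_ne_zero_of_mul hne)).2
    omega

/-! ### Exterior products and the two Leibniz rules -/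

/-- The exterior product of cochains, as a cochain of the join. -/
def cross (K : FinComplex n) (L : FinComplex m) (i₁ i₂ i : ℤ) :
    K.Cochain i₁ →ₗ[ℝ] L.Cochain i₂ →ₗ[ℝ] (K.join L).Cochain i :=
  LinearMap.mk₂ ℝ (fun f g A => K.extend f (leftPart A.1) * L.extend g (rightPart A.1))
    (fun f f' g => by funext A; simp [extend_add, add_mul])
    (fun c f g => by funext A; simp [extend_smul, mul_assoc])
    (fun f g g' => by funext A; simp [extend_add, mul_add])
    (fun c f g => by funext A; simp [extend_smul, mul_left_comm])

theorem cross_apply (K : FinComplex n) (L : FinComplex m) {i₁ i₂ i : ℤ} (f : K.Cochain i₁)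
    (g : L.Cochain i₂) (A : (K.join L).Face i) :
    K.cross L i₁ i₂ i f g A = K.extend f (leftPart A.1) * L.extend g (rightPart A.1) := rfl

theorem extend_cross (K : FinComplex n) (L : FinComplex m) {i₁ i₂ i : ℤ} (hi : i = i₁ + i₂ + 1)
    (f : K.Cochain i₁) (g : L.Cochain i₂) (F : Finset (Fin n)) (G : Finset (Fin m)) :
    (K.join L).extend (K.cross L i₁ i₂ i f g) (joinFace F G) = K.extend f F * L.extend g G := by
  rw [extend]
  split_ifs with h
  · rw [cross_apply, leftPart_joinFace, rightPart_joinFace]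
  · by_contra hne
    have h1 := mem_of_extend_ne_zero (left_ne_zero_of_mul (Ne.symm hne))
    have h2 := mem_of_extend_ne_zero (right_ne_zero_of_mul (Ne.symm hne))
    refine h ⟨joinFace_mem_join.mpr ⟨h1.1, h2.1⟩, ?_⟩
    rw [faceDim_joinFace, h1.2, h2.2, hi]

/-- Cochains of the join agree if their extensions agree on joins of faces. -/
theorem join_cochain_ext (K : FinComplex n) (L : FinComplex m) {i : ℤ}
    {a b : (K.join L).Cochain i}
    (h : ∀ F ∈ K.faces, ∀ G ∈ L.faces,
      (K.join L).extend a (joinFace F G) = (K.join L).extend b (joinFace F G)) : a = b := by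
  funext A
  rw [← extend_coe _ a, ← extend_coe _ b]
  have hA := A.2.1
  rw [← joinFace_leftPart_rightPart A.1] at hA ⊢
  exact h _ (joinFace_mem_join.mp hA).1 _ (joinFace_mem_join.mp hA).2

/-- A face of dimension `i` has `i + 1` vertices, and elsewhere both sides vanish. This turns the
sign of `incidence_joinFace`, which depends on the face, into the constant sign of the Leibniz
rules. -/
theorem pow_card_mul_extend (K : FinComplex n) {i : ℤ} (f : K.Cochain i) (F : Finset (Fin n)) :
    (-1 : ℝ) ^ F.card * K.extend f F = (-1 : ℝ) ^ (i + 1) * K.extend f F := by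
  by_cases h : K.extend f F = 0
  · rw [h, mul_zero, mul_zero]
  · have h1 : i + 1 = (F.card : ℤ) := by
      rw [← (mem_of_extend_ne_zero h).2, faceDim]
      ring
    rw [h1, zpow_natCast]

theorem coboundary_cross (K : FinComplex n) (L : FinComplex m) {i₁ i₂ j₁ j₂ i j : ℤ}
    (h₁ : j₁ = i₁ + 1) (h₂ : j₂ = i₂ + 1) (hi : i = i₁ + i₂ + 1) (hj : j = i + 1)
    (f : K.Cochain i₁) (g : L.Cochain i₂) :
    (K.join L).coboundary i j (K.cross L i₁ i₂ i f g) =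
      K.cross L j₁ i₂ j (K.coboundary i₁ j₁ f) g +
        (-1 : ℝ) ^ (i₁ + 1) • K.cross L i₁ j₂ j f (L.coboundary i₂ j₂ g) := by
  refine join_cochain_ext K L fun F hF G hG => ?_
  rw [extend_coboundary _ hj _ (joinFace_mem_join.mpr ⟨hF, hG⟩), extend_add, extend_smul,
    extend_cross K L (by omega), extend_cross K L (by omega), extend_coboundary _ h₁ _ hF,
    extend_coboundary _ h₂ _ hG, sum_finset_join]
  simp only [incidence_joinFace, extend_cross K L hi, add_mul, Finset.sum_add_distrib, ite_mul,
    zero_mul, Finset.sum_ite_eq', Finset.sum_ite_irrel, Finset.mem_univ, if_true,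
    Finset.sum_const_zero]
  rw [← mul_assoc, ← pow_card_mul_extend, Finset.sum_mul, Finset.mul_sum]
  congr 1
  · exact Finset.sum_congr rfl fun _ _ => by ring
  · exact Finset.sum_congr rfl fun _ _ => by ring

/-- In the quotient of join weights along an edge of incidence only one factor changes, so the
weight of the other one cancels. What remains is the quotient of the weights of the changing factor
times a ratio of values of `p` or `q`. -/
theorem coboundaryAdjoint_cross (K : FinComplex n) (L : FinComplex m) {w₁ : Finset (Fin n) → ℝ}
    {w₂ : Finset (Fin m) → ℝ} (hw₁ : ∀ F ∈ K.faces, 0 < w₁ F) (hw₂ : ∀ G ∈ L.faces, 0 < w₂ G)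
    {p q : ℤ → ℝ} (hp : ∀ F ∈ K.faces, 0 < p (faceDim F)) (hq : ∀ G ∈ L.faces, 0 < q (faceDim G))
    {i₁ i₂ j₁ j₂ i j : ℤ} (h₁ : j₁ = i₁ + 1) (h₂ : j₂ = i₂ + 1) (hi : j = j₁ + j₂ + 1)
    (hj : j = i + 1) (f : K.Cochain j₁) (g : L.Cochain j₂) :
    (K.join L).coboundaryAdjoint (joinWeight p q w₁ w₂) i j (K.cross L j₁ j₂ j f g) =
      (p j₁ / p i₁) • K.cross L i₁ j₂ i (K.coboundaryAdjoint w₁ i₁ j₁ f) g +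
        ((-1 : ℝ) ^ (j₁ + 1) * (q j₂ / q i₂)) •
          K.cross L j₁ i₂ i f (L.coboundaryAdjoint w₂ i₂ j₂ g) := by
  refine join_cochain_ext K L fun E hE D hD => ?_
  rw [extend_coboundaryAdjoint _ _ hj _ (joinFace_mem_join.mpr ⟨hE, hD⟩), extend_add, extend_smul,
    extend_smul, extend_cross K L (by omega), extend_cross K L (by omega),
    extend_coboundaryAdjoint _ _ h₁ _ hE, extend_coboundaryAdjoint _ _ h₂ _ hD, sum_finset_join]
  simp only [incidence_joinFace, extend_cross K L hi, joinWeight_joinFace, mul_add, add_mul,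
    Finset.sum_add_distrib, ite_mul, mul_ite, mul_zero, zero_mul, Finset.sum_ite_eq,
    Finset.sum_ite_irrel, Finset.mem_univ, if_true, Finset.sum_const_zero]
  congr 1
  · rw [Finset.sum_mul, Finset.mul_sum]
    refine Finset.sum_congr rfl fun F _ => ?_
    have hqw := (mul_pos (hq D hD) (hw₂ D hD)).ne'
    -- Only for a nonzero term are the dimensions of `F` and `E` known to be `j₁` and `i₁`, so that
    -- the quotient of values of `p` is the stated constant. All other terms vanish on both sides.
    by_cases hne : incidence E F * K.extend f F = 0
    · linear_combination (p (faceDim F) * w₁ F * (q (faceDim D) * w₂ D) /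
        (p (faceDim E) * w₁ E * (q (faceDim D) * w₂ D)) * L.extend g D -
        p j₁ / p i₁ * (w₁ F / w₁ E) * L.extend g D) * hne
    · have hF := (mem_of_extend_ne_zero (right_ne_zero_of_mul hne)).2
      have hd := faceDim_of_incidence_ne_zero (left_ne_zero_of_mul hne)
      rw [hF, (by omega : faceDim E = i₁), mul_div_mul_right _ _ hqw, mul_div_mul_comm]
      ring
  · rw [mul_mul_mul_comm ((-1 : ℝ) ^ (j₁ + 1)), ← pow_card_mul_extend, Finset.mul_sum,
      Finset.mul_sum]
    refine Finset.sum_congr rfl fun G _ => ?_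
    have hpw := (mul_pos (hp E hE) (hw₁ E hE)).ne'
    by_cases hne : incidence D G * L.extend g G = 0
    · linear_combination (p (faceDim E) * w₁ E * (q (faceDim G) * w₂ G) /
        (p (faceDim E) * w₁ E * (q (faceDim D) * w₂ D)) * (-1 : ℝ) ^ E.card * K.extend f E -
        q j₂ / q i₂ * (w₂ G / w₂ D) * (-1 : ℝ) ^ E.card * K.extend f E) * hne
    · have hG := (mem_of_extend_ne_zero (right_ne_zero_of_mul hne)).2
      have hd := faceDim_of_incidence_ne_zero (left_ne_zero_of_mul hne)
      rw [hG, (by omega : faceDim D = i₂), mul_div_mul_left _ _ hpw, mul_div_mul_comm]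
      ring

/-- On exterior products, the Laplace operator of the join is a sum of operators of the factors. -/
theorem lap_cross (K : FinComplex n) (L : FinComplex m) {w₁ : Finset (Fin n) → ℝ}
    {w₂ : Finset (Fin m) → ℝ} (hw₁ : ∀ F ∈ K.faces, 0 < w₁ F) (hw₂ : ∀ G ∈ L.faces, 0 < w₂ G)
    {p q : ℤ → ℝ} (hp : ∀ F ∈ K.faces, 0 < p (faceDim F)) (hq : ∀ G ∈ L.faces, 0 < q (faceDim G))
    {i₁ i₂ i : ℤ} (hi : i = i₁ + i₂ + 1) (f : K.Cochain i₁) (g : L.Cochain i₂) :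
    (K.join L).lap (joinWeight p q w₁ w₂) i (K.cross L i₁ i₂ i f g) =
      K.cross L i₁ i₂ i ((p (i₁ + 1) / p i₁) • K.lapUp w₁ i₁ f +
        (p i₁ / p (i₁ - 1)) • K.lapDown w₁ i₁ f) g +
      K.cross L i₁ i₂ i f ((q (i₂ + 1) / q i₂) • L.lapUp w₂ i₂ g +
        (q i₂ / q (i₂ - 1)) • L.lapDown w₂ i₂ g) := by
  simp only [lap, lapUp, lapDown, LinearMap.add_apply, LinearMap.comp_apply]
  rw [coboundary_cross K L rfl rfl hi rfl,
    coboundaryAdjoint_cross K L hw₁ hw₂ hp hq (i₁ := i₁ - 1) (i₂ := i₂ - 1) (by ring) (by ring) hi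
      (by ring)]
  simp only [map_add, map_smul, LinearMap.add_apply, LinearMap.smul_apply]
  rw [coboundaryAdjoint_cross K L hw₁ hw₂ hp hq (i₁ := i₁) (i₂ := i₂ - 1) rfl (by ring)
      (by omega) rfl,
    coboundaryAdjoint_cross K L hw₁ hw₂ hp hq (i₁ := i₁ - 1) (i₂ := i₂) (by ring) rfl
      (by omega) rfl,
    coboundary_cross K L (j₁ := i₁) (j₂ := i₂ + 1) (by ring) rfl (by omega) (by ring),
    coboundary_cross K L (j₁ := i₁ + 1) (j₂ := i₂) rfl (by ring) (by omega) (by ring)]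
  have hs : ∀ k : ℤ, (-1 : ℝ) ^ (k + 1) = -(-1 : ℝ) ^ k := fun k => by
    rw [zpow_add_one₀ (by norm_num)]
    ring
  have hsq : (-1 : ℝ) ^ i₁ * (-1 : ℝ) ^ i₁ = 1 := by
    rw [← mul_zpow]
    norm_num
  have hpred : i₁ - 1 + 1 = i₁ := by ring
  simp only [hs, hpred]
  -- With the value of `(-1) ^ i₁` fixed, all signs are explicit: the mixed terms cancel and the
  -- sign in front of the second factor's operators squares to one.
  rcases mul_self_eq_one_iff.mp hsq with h | h <;> rw [h] <;> module

end FinComplex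

/-! ### An eigenbasis of the join and its spectrum -/

theorem neg_one_le_faceDim {n : ℕ} (F : Finset (Fin n)) : -1 ≤ faceDim F := by
  simp only [faceDim]
  omega

theorem map_product_map {α β γ δ : Type} (s : Multiset α) (t : Multiset β) (f : α → γ)
    (g : β → δ) : s.map f ×ˢ t.map g = (s ×ˢ t).map (Prod.map f g) := by
  induction s using Multiset.induction with
  | empty => simp
  | cons a s ih => simp [ih, Multiset.cons_product]

theorem map_univ_val_eq_sum {α β : Type} [Fintype α] (g : α → β) :
    (Finset.univ : Finset α).val.map g = ∑ x, {g x} := by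
  rw [Finset.sum_eq_multiset_sum, ← Multiset.sum_map_singleton (Multiset.map g _),
    Multiset.map_map]
  rfl

namespace FinComplex

variable {n m : ℕ}

/-- The faces of the join of a given dimension are the joins of faces of complementary dimensions. -/
theorem card_face_join (K : FinComplex n) (L : FinComplex m) (i : ℤ) :
    Fintype.card (Σ i₁ : Finset.Icc (-1 : ℤ) i, K.Face i₁ × L.Face (i - 1 - i₁)) =
      Fintype.card ((K.join L).Face i) := by
  refine Fintype.card_of_bijective (f := fun x => ⟨joinFace x.2.1.1 x.2.2.1,
    joinFace_mem_join.mpr ⟨x.2.1.2.1, x.2.2.2.1⟩, by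
      rw [faceDim_joinFace, x.2.1.2.2, x.2.2.2.2]
      ring⟩) ⟨?_, ?_⟩
  · rintro ⟨⟨i₁, h₁⟩, ⟨F, hF⟩, ⟨G, hG⟩⟩ ⟨⟨j₁, h₁'⟩, ⟨F', hF'⟩, ⟨G', hG'⟩⟩ h
    obtain ⟨rfl, rfl⟩ := joinFace_inj.mp (congrArg Subtype.val h)
    obtain rfl : i₁ = j₁ := hF.2.symm.trans hF'.2
    rfl
  · rintro ⟨A, hA⟩
    rw [← joinFace_leftPart_rightPart A, joinFace_mem_join, faceDim_joinFace] at hA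
    have h1 : -1 ≤ faceDim (leftPart A) := neg_one_le_faceDim _
    have h2 : -1 ≤ faceDim (rightPart A) := neg_one_le_faceDim _
    exact ⟨⟨⟨faceDim (leftPart A), Finset.mem_Icc.mpr ⟨h1, by omega⟩⟩,
      ⟨leftPart A, hA.1.1, rfl⟩, ⟨rightPart A, hA.1.2, by simp only; omega⟩⟩,
      Subtype.ext (joinFace_leftPart_rightPart A)⟩

theorem extend_single (K : FinComplex n) {i : ℤ} (F : K.Face i) (E : Finset (Fin n)) :
    K.extend (Pi.single F 1) E = if E = F.1 then 1 else 0 := by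
  by_cases h : E = F.1
  · rw [if_pos h, h, extend_coe, Pi.single_eq_same]
  · rw [if_neg h, extend]
    split_ifs with hE
    · exact Pi.single_eq_of_ne (fun h' => h (congrArg Subtype.val h')) _
    · rfl

/-- The exterior products of bases span the cochain space of the join. -/
theorem span_cross_eq_top (K : FinComplex n) (L : FinComplex m) (i : ℤ)
    {ι κ : ℤ → Type} (b : ∀ j, Module.Basis (ι j) ℝ (K.Cochain j))
    (c : ∀ j, Module.Basis (κ j) ℝ (L.Cochain j)) :
    ⊤ ≤ Submodule.span ℝ (Set.range
      fun x : Σ i₁ : Finset.Icc (-1 : ℤ) i, ι i₁ × κ (i - 1 - i₁) =>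
        K.cross L x.1 (i - 1 - x.1) i (b x.1 x.2.1) (c (i - 1 - x.1) x.2.2)) := by
  set S := Submodule.span ℝ (Set.range
      fun x : Σ i₁ : Finset.Icc (-1 : ℤ) i, ι i₁ × κ (i - 1 - i₁) =>
        K.cross L x.1 (i - 1 - x.1) i (b x.1 x.2.1) (c (i - 1 - x.1) x.2.2))
  -- By bilinearity, products of basis vectors generate all exterior products. It then suffices to
  -- exhibit each elementary cochain of the join as the product of two elementary cochains.
  have hcross : ∀ i₁ ∈ Finset.Icc (-1 : ℤ) i, ∀ f g, K.cross L i₁ (i - 1 - i₁) i f g ∈ S := by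
    intro i₁ h₁ f g
    have h : K.cross L i₁ (i - 1 - i₁) i f g ∈ Submodule.map₂ (K.cross L i₁ (i - 1 - i₁) i) ⊤ ⊤ :=
      Submodule.apply_mem_map₂ _ trivial trivial
    rw [← (b i₁).span_eq, ← (c (i - 1 - i₁)).span_eq, Submodule.map₂_span_span] at h
    refine Submodule.span_mono ?_ h
    rintro _ ⟨_, ⟨j, rfl⟩, _, ⟨k, rfl⟩, rfl⟩
    exact ⟨⟨⟨i₁, h₁⟩, j, k⟩, rfl⟩
  rw [← (Pi.basisFun ℝ ((K.join L).Face i)).span_eq, Submodule.span_le]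
  rintro _ ⟨A, rfl⟩
  have hA := A.2
  rw [← joinFace_leftPart_rightPart A.1, joinFace_mem_join, faceDim_joinFace] at hA
  have h1 : -1 ≤ faceDim (leftPart A.1) := neg_one_le_faceDim _
  have h2 : -1 ≤ faceDim (rightPart A.1) := neg_one_le_faceDim _
  let F : K.Face (faceDim (leftPart A.1)) := ⟨leftPart A.1, hA.1.1, rfl⟩
  let G : L.Face (i - 1 - faceDim (leftPart A.1)) := ⟨rightPart A.1, hA.1.2, by omega⟩
  suffices h : Pi.basisFun ℝ ((K.join L).Face i) A =
      K.cross L _ _ i (Pi.single F 1) (Pi.single G 1) by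
    rw [h]
    exact hcross _ (Finset.mem_Icc.mpr ⟨h1, by omega⟩) _ _
  refine join_cochain_ext K L fun E hE D hD => ?_
  rw [extend_cross K L (by ring), Pi.basisFun_apply]
  rw [extend_single, extend_single, extend_single]
  have h : joinFace E D = A.1 ↔ E = leftPart A.1 ∧ D = rightPart A.1 := by
    refine ⟨fun h => ?_, fun h => ?_⟩
    · rw [← h, leftPart_joinFace, rightPart_joinFace]
      exact ⟨rfl, rfl⟩
    · rw [h.1, h.2, joinFace_leftPart_rightPart]
  simp only [h, ite_and, F, G, ite_mul, one_mul, zero_mul]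

/-- At most one of the positive and negative parts of `x` is nonzero, so the choice of ratio by
label becomes the two-term sum that `lap_cross` produces. -/
theorem lapLabel_ratio_mul (p : ℤ → ℝ) (i : ℤ) (x : ℝ) :
    ratio p i (lapLabel x).1 * (lapLabel x).2 =
      p (i + 1) / p i * max x 0 + p i / p (i - 1) * max (-x) 0 := by
  rw [lapLabel]
  split_ifs with h
  · rw [max_eq_right h.le, max_eq_left (neg_nonneg.mpr h.le), mul_zero, zero_add, ratio]
  · rw [max_eq_left (not_lt.mp h), max_eq_right (neg_nonpos.mpr (not_lt.mp h)), mul_zero, add_zero,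
      ratio]

/-- The spectrum of the Laplace operator of a join. -/
theorem eigenvalues_lap_join (K : FinComplex n) (L : FinComplex m) {w₁ : Finset (Fin n) → ℝ}
    {w₂ : Finset (Fin m) → ℝ} (hw₁ : ∀ F ∈ K.faces, 0 < w₁ F) (hw₂ : ∀ G ∈ L.faces, 0 < w₂ G)
    {p q : ℤ → ℝ} (hp : ∀ F ∈ K.faces, 0 < p (faceDim F)) (hq : ∀ G ∈ L.faces, 0 < q (faceDim G))
    (i : ℤ) :
    eigenvalues ((K.join L).lap (joinWeight p q w₁ w₂) i) =
      ∑ i₁ ∈ Finset.Icc (-1 : ℤ) i,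
        (K.labelledSpectrum w₁ i₁ ×ˢ L.labelledSpectrum w₂ (i - 1 - i₁)).map
          (fun x => ratio p i₁ x.1.1 * x.1.2 + ratio q (i - 1 - i₁) x.2.1 * x.2.2) := by
  choose b μ hb using K.exists_lap_eigenbasis hw₁
  choose c ν hc using L.exists_lap_eigenbasis hw₂
  let v := fun x : Σ i₁ : Finset.Icc (-1 : ℤ) i, K.Face i₁ × L.Face (i - 1 - i₁) =>
    K.cross L x.1 (i - 1 - x.1) i (b x.1 x.2.1) (c (i - 1 - x.1) x.2.2)
  -- The family spans and `card_face_join` gives it as many members as the dimension, so linear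
  -- independence needs no separate argument.
  let B := basisOfTopLeSpanOfCardEqFinrank v (K.span_cross_eq_top L i b c)
    (by rw [card_face_join, Module.finrank_fintype_fun_eq_card])
  have hB : ∀ x, (K.join L).lap (joinWeight p q w₁ w₂) i (B x) =
      (ratio p x.1 (lapLabel (μ x.1 x.2.1)).1 * (lapLabel (μ x.1 x.2.1)).2 +
        ratio q (i - 1 - x.1) (lapLabel (ν (i - 1 - x.1) x.2.2)).1 *
          (lapLabel (ν (i - 1 - x.1) x.2.2)).2) • B x := fun x => by
    simp only [B, coe_basisOfTopLeSpanOfCardEqFinrank, v]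
    rw [lap_cross K L hw₁ hw₂ hp hq (by ring), (hb _ _).1, (hb _ _).2, (hc _ _).1, (hc _ _).2,
      lapLabel_ratio_mul, lapLabel_ratio_mul]
    simp only [map_add, map_smul, LinearMap.add_apply, LinearMap.smul_apply]
    module
  rw [eigenvalues_eq_of_basis B hB, ← Finset.sum_coe_sort]
  simp only [labelledSpectrum_eq_of_basis K w₁ _ (b _) (μ _) (hb _),
    labelledSpectrum_eq_of_basis L w₂ _ (c _) (ν _) (hc _)]
  rw [map_univ_val_eq_sum, Fintype.sum_sigma]
  refine Finset.sum_congr rfl fun i₁ _ => ?_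
  rw [← map_univ_val_eq_sum, ← Finset.univ_product_univ, Finset.product_val, map_product_map,
    Multiset.map_map]
  rfl

end FinComplex

end

theorem theorem6p5 {n m : ℕ} (K₁ : FinComplex n) (K₂ : FinComplex m)
    (w₁ : Finset (Fin n) → ℝ) (w₂ : Finset (Fin m) → ℝ)
    (hw₁ : ∀ F ∈ K₁.faces, 0 < w₁ F) (hw₂ : ∀ G ∈ K₂.faces, 0 < w₂ G)
    (p q : ℤ → ℝ)
    (hp : ∀ k : ℤ, -1 ≤ k → k ≤ K₁.dim → 0 < p k)
    (hq : ∀ k : ℤ, -1 ≤ k → k ≤ K₂.dim → 0 < q k)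
    (i : ℤ) :
    EqUpToZeros (eigenvalues ((K₁.join K₂).lap (joinWeight p q w₁ w₂) i))
      (∑ i₁ ∈ Finset.Icc (-1 : ℤ) i,
        (K₁.labelledSpectrum w₁ i₁ ×ˢ K₂.labelledSpectrum w₂ (i - 1 - i₁)).map
          (fun x => ratio p i₁ x.1.1 * x.1.2 + ratio q (i - 1 - i₁) x.2.1 * x.2.2)) :=
  -- Positivity of `p` and `q` is needed only at dimensions of faces. A ratio that involves a value
  -- outside this range multiplies only zero eigenvalues, because the neighbouring cochain space is
  -- then zero.
  congrArg (Multiset.filter (· ≠ 0)) (K₁.eigenvalues_lap_join K₂ hw₁ hw₂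
    (fun _ hF => hp _ (neg_one_le_faceDim _) (K₁.faceDim_le_dim hF))
    (fun _ hG => hq _ (neg_one_le_faceDim _) (K₂.faceDim_le_dim hG)) i)
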